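/- Let $\mathrm{LJ}$ be Gentzen's first-order intuitionistic sequent calculus, with primitive logical symbols $\neg,\land,\lor,\supset,\forall,\exists$, initial sequents $A\rightarrow A$ for all formulas $A$, and sequents $\Gamma\rightarrow\Lambda$ in which $\Gamma$ is a finite sequence of formulas and $\Lambda$ consists of at most one formula. Let $\mathrm{ML}$ (minimal logic) be $\mathrm{LJ}$ without the rule of weakening on the right, and let $\mathrm{ML}^+$ be $\mathrm{ML}$ together with the rule $$\frac{A,\Gamma\rightarrow\Lambda\qquad \neg A,\Gamma\rightarrow\Lambda}{\Gamma\rightarrow\Lambda}\qquad(A\text{ any formula}).$$ The degree of a formula is given by $\partial(A)=1$ for $A$ atomic, $\partial(A\land B)=\partial(A\lor B)=\partial(A\supset B)=\max(\partial(A),\partial(B))+1$ and $\partial(\neg A)=\partial(\forall x A)=\partial(\exists x A)=\partial(A)+1$. The degree of a proof is the least upper bound of the degrees of the cut formulas of its cut rules (so it is $0$ if the proof is cut-free). Let $S$ be one of the systems $\mathrm{ML}$, $\mathrm{ML}^+$, let $C$ be a formula of degree $n$, and let $\pi,\pi'$ be proofs in $S$, of degrees $<n$, of $\Gamma\rightarrow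 C$ and $\Pi\rightarrow\Lambda$ respectively. Let $\Pi-C$ be any sequence obtained from $\Pi$ by deleting an arbitrary number (possibly none, possibly all) of the occurrences of $C$. Then there is a proof in $S$ of degree $<n$ of $\Gamma,\Pi-C\rightarrow\Lambda$. -/

import Mathlib

namespace MinLogic

open FirstOrder FirstOrder.Language

/-- First-order formulas over the (constant, function and predicate) symbols of `L`, with the
primitive logical symbols `¬, ∧, ∨, ⊃, ∀, ∃`.  The free variables are the natural numbers (left
summand); `Fin k` (right summand) are the bound variables whose quantifiers lie further out.
A quantifier applied to a member of `Fml L (k + 1)` binds the variable `Fin.last k`. -/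
inductive Fml (L : Language) : ℕ → Type _
  | rel {k l : ℕ} (R : L.Relations l) (ts : Fin l → L.Term (ℕ ⊕ Fin k)) : Fml L k
  | neg {k : ℕ} (A : Fml L k) : Fml L k
  | and {k : ℕ} (A B : Fml L k) : Fml L k
  | or {k : ℕ} (A B : Fml L k) : Fml L k
  | imp {k : ℕ} (A B : Fml L k) : Fml L k
  | all {k : ℕ} (A : Fml L (k + 1)) : Fml L k
  | ex {k : ℕ} (A : Fml L (k + 1)) : Fml L k

/-- Formulas in which every bound variable is bound; they may contain free variables. -/
abbrev Formula (L : Language) := Fml L 0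

namespace Fml

/-- The degree of a formula. -/
def degree {L : Language} : {k : ℕ} → Fml L k → ℕ
  | _, rel _ _ => 1
  | _, neg A => A.degree + 1
  | _, and A B => max A.degree B.degree + 1
  | _, or A B => max A.degree B.degree + 1
  | _, imp A B => max A.degree B.degree + 1
  | _, all A => A.degree + 1
  | _, ex A => A.degree + 1

/-- The free variable `a` occurs in the formula. -/
def Occurs {L : Language} (a : ℕ) : {k : ℕ} → Fml L k → Prop
  | _, rel _ ts => ∃ i, a ∈ (ts i).varFinsetLeft
  | _, neg A => A.Occurs a
  | _, and A B => A.Occurs a ∨ B.Occurs a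
  | _, or A B => A.Occurs a ∨ B.Occurs a
  | _, imp A B => A.Occurs a ∨ B.Occurs a
  | _, all A => A.Occurs a
  | _, ex A => A.Occurs a

/-- `A.inst t` is `A(t)`: the term `t` replaces the outermost bound variable `0`, and the
variables of the inner quantifiers are renumbered.  No variable of `t` can be captured. -/
def inst {L : Language} (t : L.Term ℕ) : {k : ℕ} → Fml L (k + 1) → Fml L k
  | _, rel R ts => rel R fun i => (ts i).subst
      (Sum.elim (fun a => Term.var (Sum.inl a))
        (Fin.cases (t.relabel Sum.inl) fun j => Term.var (Sum.inr j)))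
  | _, neg A => neg (A.inst t)
  | _, and A B => and (A.inst t) (B.inst t)
  | _, or A B => or (A.inst t) (B.inst t)
  | _, imp A B => imp (A.inst t) (B.inst t)
  | _, all A => all (A.inst t)
  | _, ex A => ex (A.inst t)

end Fml

/-- The free variable `a` does not occur in the sequent `Γ → Λ`. -/
def Fresh {L : Language} (a : ℕ) (Γ : List (Formula L)) (Λ : Option (Formula L)) : Prop :=
  (∀ A ∈ Γ, ¬ A.Occurs a) ∧ ∀ A ∈ Λ, ¬ A.Occurs a

/-- The two systems: minimal logic, and minimal logic with tertium non datur. -/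
inductive System
  | ML
  | MLplus

/-- `Proof S Γ Λ` is the type of proofs in `S` of the sequent `Γ → Λ`, whose succedent `Λ` is
empty or a single formula: the rules of the intuitionistic sequent calculus LJ except weakening
on the right and, in `MLplus`, additionally the rule `tnd`. -/
inductive Proof {L : Language} (S : System) : List (Formula L) → Option (Formula L) → Type _
  | ax (A : Formula L) : Proof S [A] (some A)
  | weakL {Γ : List (Formula L)} {Λ : Option (Formula L)} (A : Formula L)
      (p : Proof S Γ Λ) : Proof S (A :: Γ) Λ
  | contrL {Γ : List (Formula L)} {Λ : Option (Formula L)} {A : Formula L}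
      (p : Proof S (A :: A :: Γ) Λ) : Proof S (A :: Γ) Λ
  | exchL {Γ Δ : List (Formula L)} {Λ : Option (Formula L)} {A B : Formula L}
      (p : Proof S (Γ ++ A :: B :: Δ) Λ) : Proof S (Γ ++ B :: A :: Δ) Λ
  | cut {Γ Δ : List (Formula L)} {Λ : Option (Formula L)} (A : Formula L)
      (p : Proof S Γ (some A)) (q : Proof S (A :: Δ) Λ) : Proof S (Γ ++ Δ) Λ
  | negL {Γ : List (Formula L)} {A : Formula L}
      (p : Proof S Γ (some A)) : Proof S (A.neg :: Γ) none
  | negR {Γ : List (Formula L)} {A : Formula L}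
      (p : Proof S (A :: Γ) none) : Proof S Γ (some A.neg)
  | andL₁ {Γ : List (Formula L)} {Λ : Option (Formula L)} {A : Formula L} (B : Formula L)
      (p : Proof S (A :: Γ) Λ) : Proof S (A.and B :: Γ) Λ
  | andL₂ {Γ : List (Formula L)} {Λ : Option (Formula L)} (A : Formula L) {B : Formula L}
      (p : Proof S (B :: Γ) Λ) : Proof S (A.and B :: Γ) Λ
  | andR {Γ : List (Formula L)} {A B : Formula L}
      (p : Proof S Γ (some A)) (q : Proof S Γ (some B)) : Proof S Γ (some (A.and B))
  | orL {Γ : List (Formula L)} {Λ : Option (Formula L)} {A B : Formula L}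
      (p : Proof S (A :: Γ) Λ) (q : Proof S (B :: Γ) Λ) : Proof S (A.or B :: Γ) Λ
  | orR₁ {Γ : List (Formula L)} {A : Formula L} (B : Formula L)
      (p : Proof S Γ (some A)) : Proof S Γ (some (A.or B))
  | orR₂ {Γ : List (Formula L)} (A : Formula L) {B : Formula L}
      (p : Proof S Γ (some B)) : Proof S Γ (some (A.or B))
  | impL {Γ Δ : List (Formula L)} {Λ : Option (Formula L)} {A B : Formula L}
      (p : Proof S Γ (some A)) (q : Proof S (B :: Δ) Λ) : Proof S (A.imp B :: (Γ ++ Δ)) Λ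
  | impR {Γ : List (Formula L)} {A B : Formula L}
      (p : Proof S (A :: Γ) (some B)) : Proof S Γ (some (A.imp B))
  | allL {Γ : List (Formula L)} {Λ : Option (Formula L)} (A : Fml L 1) (t : L.Term ℕ)
      (p : Proof S (A.inst t :: Γ) Λ) : Proof S (A.all :: Γ) Λ
  | allR {Γ : List (Formula L)} (A : Fml L 1) (a : ℕ) (h : Fresh a Γ (some A.all))
      (p : Proof S Γ (some (A.inst (Term.var a)))) : Proof S Γ (some A.all)
  | exL {Γ : List (Formula L)} {Λ : Option (Formula L)} (A : Fml L 1) (a : ℕ)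
      (h : Fresh a (A.ex :: Γ) Λ)
      (p : Proof S (A.inst (Term.var a) :: Γ) Λ) : Proof S (A.ex :: Γ) Λ
  | exR {Γ : List (Formula L)} (A : Fml L 1) (t : L.Term ℕ)
      (p : Proof S Γ (some (A.inst t))) : Proof S Γ (some A.ex)
  | tnd {Γ : List (Formula L)} {Λ : Option (Formula L)} (h : S = System.MLplus) (A : Formula L)
      (p : Proof S (A :: Γ) Λ) (q : Proof S (A.neg :: Γ) Λ) : Proof S Γ Λ

namespace Proof

/-- The set of the degrees of the cut rules of a proof (that is, of their cut formulas). -/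
def cutDegrees {L : Language} {S : System} :
    {Γ : List (Formula L)} → {Λ : Option (Formula L)} → Proof S Γ Λ → Finset ℕ
  | _, _, ax _ => ∅
  | _, _, weakL _ p => p.cutDegrees
  | _, _, contrL p => p.cutDegrees
  | _, _, exchL p => p.cutDegrees
  | _, _, cut A p q => {A.degree} ∪ (p.cutDegrees ∪ q.cutDegrees)
  | _, _, negL p => p.cutDegrees
  | _, _, negR p => p.cutDegrees
  | _, _, andL₁ _ p => p.cutDegrees
  | _, _, andL₂ _ p => p.cutDegrees
  | _, _, andR p q => p.cutDegrees ∪ q.cutDegrees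
  | _, _, orL p q => p.cutDegrees ∪ q.cutDegrees
  | _, _, orR₁ _ p => p.cutDegrees
  | _, _, orR₂ _ p => p.cutDegrees
  | _, _, impL p q => p.cutDegrees ∪ q.cutDegrees
  | _, _, impR p => p.cutDegrees
  | _, _, allL _ _ p => p.cutDegrees
  | _, _, allR _ _ _ p => p.cutDegrees
  | _, _, exL _ _ _ p => p.cutDegrees
  | _, _, exR _ _ p => p.cutDegrees
  | _, _, tnd _ _ p q => p.cutDegrees ∪ q.cutDegrees

/-- The degree of a proof: the least upper bound of the degrees of its cut rules, which is `0`
for a cut-free proof. -/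
def degree {L : Language} {S : System} {Γ : List (Formula L)} {Λ : Option (Formula L)}
    (p : Proof S Γ Λ) : ℕ :=
  p.cutDegrees.sup id

end Proof

/-- `Deletion C Δ Δ'`: the sequence `Δ'` arises from `Δ` by deleting an arbitrary number
(possibly none, possibly all) of the occurrences of `C`. -/
inductive Deletion {L : Language} (C : Formula L) : List (Formula L) → List (Formula L) → Prop
  | nil : Deletion C [] []
  | keep (A : Formula L) {Δ Δ' : List (Formula L)} (h : Deletion C Δ Δ') :
      Deletion C (A :: Δ) (A :: Δ')
  | drop {Δ Δ' : List (Formula L)} (h : Deletion C Δ Δ') : Deletion C (C :: Δ) Δ'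

end MinLogic

/-! The statement is cut elimination for a single cut on `C` of degree `n`, where cuts of smaller
degree are free. It is proved in an auxiliary calculus, `Derives`, whose antecedents matter only as
sets and in which ∀-right and ∃-left have one premise for every term. There weakening and
contraction cost nothing, and no eigenvariable has to be renamed.

In this calculus `Derives.cut_admissible` pushes the cut up the left derivation. Left rules, smaller
cuts and tertium non datur act on formulas other than the succedent `C`, so they permute below the
cut; an axiom makes the cut trivial. What remains is a right rule introducing `C`. Then
`Derives.cut_of_rightPremises` pushes the cut up the right derivation until a left rule acts on `C`,
where it is replaced by cuts on immediate subformulas or instances of `C`, all of degree `< n`.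

The two translations preserve the bound on cut degrees. `Proof.derives_subst` turns an eigenvariable
premise into premises for all terms by substitution; `Derives.provable` goes back by keeping only
the premise at a fresh variable. -/

namespace MinLogic

open FirstOrder FirstOrder.Language

/-! ### Substitution of terms for free variables, and fresh variables -/

section Substitution

variable {L : Language}

/-- The substitution on terms with bound variables that is induced by a substitution of terms
for the free variables. -/
def liftSubst (σ : ℕ → L.Term ℕ) (k : ℕ) : ℕ ⊕ Fin k → L.Term (ℕ ⊕ Fin k) :=
  Sum.elim (fun a => (σ a).relabel Sum.inl) fun j => Term.var (Sum.inr j)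

/-- The substitution of a term for the outermost bound variable. -/
def instSubst (t : L.Term ℕ) (k : ℕ) : ℕ ⊕ Fin (k + 1) → L.Term (ℕ ⊕ Fin k) :=
  Sum.elim (fun a => Term.var (Sum.inl a))
    (Fin.cases (t.relabel Sum.inl) fun j => Term.var (Sum.inr j))

theorem term_subst_subst {α β γ : Type*} (s : L.Term α) (f : α → L.Term β) (g : β → L.Term γ) :
    (s.subst f).subst g = s.subst fun a => (f a).subst g := by
  induction s with
  | var a => rfl
  | func F ts ih => simp only [Term.subst, ih]

theorem term_subst_relabel {α β γ : Type*} (s : L.Term α) (f : α → β) (g : β → L.Term γ) :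
    (s.relabel f).subst g = s.subst fun a => g (f a) := by
  induction s with
  | var a => rfl
  | func F ts ih => simp only [Term.subst, Term.relabel, ih]

theorem term_relabel_subst {α β γ : Type*} (s : L.Term α) (f : α → L.Term β) (g : β → γ) :
    (s.subst f).relabel g = s.subst fun a => (f a).relabel g := by
  induction s with
  | var a => rfl
  | func F ts ih => simp only [Term.subst, Term.relabel, ih]

theorem term_subst_var {α : Type*} (s : L.Term α) : s.subst Term.var = s := by
  induction s with
  | var a => rfl
  | func F ts ih => simp only [Term.subst, ih]

theorem term_subst_eq_relabel {α β : Type*} (s : L.Term α) (f : α → β) :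
    (s.subst fun a => Term.var (f a)) = s.relabel f := by
  induction s with
  | var a => rfl
  | func F ts ih => simp only [Term.subst, Term.relabel, ih]

theorem term_subst_liftSubst_congr {k : ℕ} {σ τ : ℕ → L.Term ℕ} (s : L.Term (ℕ ⊕ Fin k))
    (h : ∀ a ∈ s.varFinsetLeft, σ a = τ a) :
    s.subst (liftSubst σ k) = s.subst (liftSubst τ k) := by
  induction s with
  | var x =>
    cases x with
    | inl a => simp [Term.subst, liftSubst, h a (by simp [Term.varFinsetLeft])]
    | inr j => rfl
  | func F ts ih =>
    simp only [Term.subst, Term.func.injEq, heq_eq_eq, true_and]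
    funext i
    refine ih i fun a ha => h a ?_
    simp only [Term.varFinsetLeft, Finset.mem_biUnion, Finset.mem_univ, true_and]
    exact ⟨i, ha⟩

namespace Fml

/-- Simultaneous substitution of terms for the free variables. -/
def subst (σ : ℕ → L.Term ℕ) : {k : ℕ} → Fml L k → Fml L k
  | k, rel R ts => rel R fun i => (ts i).subst (liftSubst σ k)
  | _, neg A => neg (A.subst σ)
  | _, and A B => and (A.subst σ) (B.subst σ)
  | _, or A B => or (A.subst σ) (B.subst σ)
  | _, imp A B => imp (A.subst σ) (B.subst σ)
  | _, all A => all (A.subst σ)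
  | _, ex A => ex (A.subst σ)

theorem subst_congr {σ τ : ℕ → L.Term ℕ} {k : ℕ} (A : Fml L k)
    (h : ∀ a, A.Occurs a → σ a = τ a) : A.subst σ = A.subst τ := by
  induction A with
  | rel R ts =>
    simp only [subst]
    congr 1
    funext i
    exact term_subst_liftSubst_congr _ fun a ha => h a ⟨i, ha⟩
  | neg A ih => simp only [subst, ih h]
  | and A B ihA ihB =>
    simp only [subst, ihA fun a ha => h a (Or.inl ha), ihB fun a ha => h a (Or.inr ha)]
  | or A B ihA ihB =>
    simp only [subst, ihA fun a ha => h a (Or.inl ha), ihB fun a ha => h a (Or.inr ha)]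
  | imp A B ihA ihB =>
    simp only [subst, ihA fun a ha => h a (Or.inl ha), ihB fun a ha => h a (Or.inr ha)]
  | all A ih => simp only [subst, ih h]
  | ex A ih => simp only [subst, ih h]

theorem subst_update_of_not_occurs {k : ℕ} (A : Fml L k) {a : ℕ} (h : ¬ A.Occurs a)
    (σ : ℕ → L.Term ℕ) (t : L.Term ℕ) : A.subst (Function.update σ a t) = A.subst σ := by
  refine A.subst_congr fun b hb => Function.update_of_ne ?_ _ _
  rintro rfl
  exact h hb

theorem subst_var {k : ℕ} (A : Fml L k) : A.subst Term.var = A := by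
  induction A with
  | @rel k l R ts =>
    have h : liftSubst (L := L) Term.var k = Term.var := by
      funext x
      cases x <;> rfl
    simp only [subst, h, term_subst_var]
  | neg A ih => simp only [subst, ih]
  | and A B ihA ihB => simp only [subst, ihA, ihB]
  | or A B ihA ihB => simp only [subst, ihA, ihB]
  | imp A B ihA ihB => simp only [subst, ihA, ihB]
  | all A ih => simp only [subst, ih]
  | ex A ih => simp only [subst, ih]

/-- At an atom both sides are single substitutions into its terms. They agree at a free variable `a`
because `σ a` contains no bound variable that the instantiation could replace. -/
theorem subst_inst (σ : ℕ → L.Term ℕ) (t : L.Term ℕ) : {k : ℕ} → (A : Fml L (k + 1)) →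
    (A.inst t).subst σ = (A.subst σ).inst (t.subst σ)
  | k, rel R ts => by
    simp only [inst, subst]
    congr 1
    funext i
    change ((ts i).subst (instSubst t k)).subst (liftSubst σ k) =
      ((ts i).subst (liftSubst σ (k + 1))).subst (instSubst (t.subst σ) k)
    rw [term_subst_subst, term_subst_subst]
    congr 1
    funext x
    rcases x with a | j
    · simp only [instSubst, liftSubst, Sum.elim_inl, Term.subst, term_subst_relabel,
        term_subst_eq_relabel]
    · refine Fin.cases ?_ (fun j => ?_) j
      · simp only [instSubst, liftSubst, Sum.elim_inr, Sum.elim_inl, Term.subst, Fin.cases_zero,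
          term_subst_relabel, term_relabel_subst]
      · simp only [instSubst, liftSubst, Sum.elim_inr, Term.subst, Fin.cases_succ]
  | _, neg A => by simp only [inst, subst, subst_inst σ t A]
  | _, and A B => by simp only [inst, subst, subst_inst σ t A, subst_inst σ t B]
  | _, or A B => by simp only [inst, subst, subst_inst σ t A, subst_inst σ t B]
  | _, imp A B => by simp only [inst, subst, subst_inst σ t A, subst_inst σ t B]
  | _, all A => by simp only [inst, subst, subst_inst σ t A]
  | _, ex A => by simp only [inst, subst, subst_inst σ t A]

/-- This turns the premise of an eigenvariable rule into the instance at any prescribed term `t`. -/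
theorem subst_inst_var {k : ℕ} (A : Fml L (k + 1)) {a : ℕ} (h : ¬ A.Occurs a)
    (σ : ℕ → L.Term ℕ) (t : L.Term ℕ) :
    (A.inst (Term.var a)).subst (Function.update σ a t) = (A.subst σ).inst t := by
  rw [subst_inst, subst_update_of_not_occurs A h]
  simp [Term.subst]

theorem degree_inst (t : L.Term ℕ) : {k : ℕ} → (A : Fml L (k + 1)) →
    (A.inst t).degree = A.degree
  | _, rel R ts => by simp only [inst, degree]
  | _, neg A => by simp only [inst, degree, degree_inst t A]
  | _, and A B => by simp only [inst, degree, degree_inst t A, degree_inst t B]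
  | _, or A B => by simp only [inst, degree, degree_inst t A, degree_inst t B]
  | _, imp A B => by simp only [inst, degree, degree_inst t A, degree_inst t B]
  | _, all A => by simp only [inst, degree, degree_inst t A]
  | _, ex A => by simp only [inst, degree, degree_inst t A]

theorem degree_subst (σ : ℕ → L.Term ℕ) {k : ℕ} (A : Fml L k) :
    (A.subst σ).degree = A.degree := by
  induction A with
  | rel R ts => rfl
  | neg A ih => simp only [subst, degree, ih]
  | and A B ihA ihB => simp only [subst, degree, ihA, ihB]
  | or A B ihA ihB => simp only [subst, degree, ihA, ihB]
  | imp A B ihA ihB => simp only [subst, degree, ihA, ihB]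
  | all A ih => simp only [subst, degree, ih]
  | ex A ih => simp only [subst, degree, ih]

theorem finite_occurs {k : ℕ} (A : Fml L k) : {a | A.Occurs a}.Finite := by
  induction A with
  | rel R ts =>
    simp only [Occurs, Set.ofPred_exists]
    exact Set.finite_iUnion fun i => (ts i).varFinsetLeft.finite_toSet
  | neg A ih => exact ih
  | and A B ihA ihB => exact ihA.union ihB
  | or A B ihA ihB => exact ihA.union ihB
  | imp A B ihA ihB => exact ihA.union ihB
  | all A ih => exact ih
  | ex A ih => exact ih

end Fml

theorem exists_fresh (Γ : List (Formula L)) (Λ : Option (Formula L)) : ∃ a, Fresh a Γ Λ := by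
  have h : (⋃ A ∈ {A | A ∈ Γ ∨ A ∈ Λ}, {a | Fml.Occurs a A}).Finite := by
    refine Set.Finite.biUnion ?_ fun A _ => A.finite_occurs
    refine (List.finite_toSet Γ).union ((List.finite_toSet Λ.toList).subset fun A hA => ?_)
    exact Option.mem_toList.2 hA
  obtain ⟨a, ha⟩ := h.exists_notMem
  simp only [Set.mem_iUnion, not_exists] at ha
  exact ⟨a, fun A hA => ha A (Or.inl hA), fun A hA => ha A (Or.inr hA)⟩

theorem Fresh.map_subst_update {a : ℕ} {Γ : List (Formula L)} {Λ : Option (Formula L)}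
    (h : Fresh a Γ Λ) (σ : ℕ → L.Term ℕ) (t : L.Term ℕ) :
    Γ.map (Fml.subst (Function.update σ a t)) = Γ.map (Fml.subst σ) ∧
      Λ.map (Fml.subst (Function.update σ a t)) = Λ.map (Fml.subst σ) :=
  ⟨List.map_congr_left fun A hA => A.subst_update_of_not_occurs (h.1 A hA) σ t,
    Option.map_congr fun A hA => A.subst_update_of_not_occurs (h.2 A hA) σ t⟩

end Substitution

/-! ### The auxiliary calculus -/

/-- `Derives S n Γ Λ`: derivability of `Γ → Λ` with cuts of degree `< n` only, in a variant of `S`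
with shared contexts, where the structural rules are built in and the eigenvariable rules are
replaced by rules with one premise for every term. -/
inductive Derives {L : Language} (S : System) (n : ℕ) :
    List (Formula L) → Option (Formula L) → Prop
  | ax {Γ : List (Formula L)} {A : Formula L} (h : A ∈ Γ) : Derives S n Γ (some A)
  | cut {Γ : List (Formula L)} {Λ : Option (Formula L)} (A : Formula L) (h : A.degree < n)
      (p : Derives S n Γ (some A)) (q : Derives S n (A :: Γ) Λ) : Derives S n Γ Λ
  | negL {Γ : List (Formula L)} {A : Formula L} (h : A.neg ∈ Γ)
      (p : Derives S n Γ (some A)) : Derives S n Γ none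
  | negR {Γ : List (Formula L)} {A : Formula L}
      (p : Derives S n (A :: Γ) none) : Derives S n Γ (some A.neg)
  | andL₁ {Γ : List (Formula L)} {Λ : Option (Formula L)} {A B : Formula L} (h : A.and B ∈ Γ)
      (p : Derives S n (A :: Γ) Λ) : Derives S n Γ Λ
  | andL₂ {Γ : List (Formula L)} {Λ : Option (Formula L)} {A B : Formula L} (h : A.and B ∈ Γ)
      (p : Derives S n (B :: Γ) Λ) : Derives S n Γ Λ
  | andR {Γ : List (Formula L)} {A B : Formula L} (p : Derives S n Γ (some A))
      (q : Derives S n Γ (some B)) : Derives S n Γ (some (A.and B))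
  | orL {Γ : List (Formula L)} {Λ : Option (Formula L)} {A B : Formula L} (h : A.or B ∈ Γ)
      (p : Derives S n (A :: Γ) Λ) (q : Derives S n (B :: Γ) Λ) : Derives S n Γ Λ
  | orR₁ {Γ : List (Formula L)} {A B : Formula L}
      (p : Derives S n Γ (some A)) : Derives S n Γ (some (A.or B))
  | orR₂ {Γ : List (Formula L)} {A B : Formula L}
      (p : Derives S n Γ (some B)) : Derives S n Γ (some (A.or B))
  | impL {Γ : List (Formula L)} {Λ : Option (Formula L)} {A B : Formula L} (h : A.imp B ∈ Γ)
      (p : Derives S n Γ (some A)) (q : Derives S n (B :: Γ) Λ) : Derives S n Γ Λ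
  | impR {Γ : List (Formula L)} {A B : Formula L}
      (p : Derives S n (A :: Γ) (some B)) : Derives S n Γ (some (A.imp B))
  | allL {Γ : List (Formula L)} {Λ : Option (Formula L)} {A : Fml L 1} (h : A.all ∈ Γ)
      (t : L.Term ℕ) (p : Derives S n (A.inst t :: Γ) Λ) : Derives S n Γ Λ
  | allR {Γ : List (Formula L)} {A : Fml L 1}
      (p : ∀ t, Derives S n Γ (some (A.inst t))) : Derives S n Γ (some A.all)
  | exL {Γ : List (Formula L)} {Λ : Option (Formula L)} {A : Fml L 1} (h : A.ex ∈ Γ)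
      (p : ∀ t, Derives S n (A.inst t :: Γ) Λ) : Derives S n Γ Λ
  | exR {Γ : List (Formula L)} {A : Fml L 1} (t : L.Term ℕ)
      (p : Derives S n Γ (some (A.inst t))) : Derives S n Γ (some A.ex)
  | tnd {Γ : List (Formula L)} {Λ : Option (Formula L)} (h : S = System.MLplus) (A : Formula L)
      (p : Derives S n (A :: Γ) Λ) (q : Derives S n (A.neg :: Γ) Λ) : Derives S n Γ Λ

namespace Derives

variable {L : Language} {S : System} {n : ℕ}

/-- Every rule only asks for membership of its principal formula in the antecedent, and there is no
freshness condition that a larger antecedent could violate. -/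
theorem weaken {Γ Γ' : List (Formula L)} {Λ : Option (Formula L)} (p : Derives S n Γ Λ)
    (h : Γ ⊆ Γ') : Derives S n Γ' Λ := by
  induction p generalizing Γ' with
  | ax hA => exact ax (h hA)
  | cut A hA _ _ ihp ihq => exact cut A hA (ihp h) (ihq (List.cons_subset_cons A h))
  | negL hA _ ih => exact negL (h hA) (ih h)
  | negR _ ih => exact negR (ih (List.cons_subset_cons _ h))
  | andL₁ hA _ ih => exact andL₁ (h hA) (ih (List.cons_subset_cons _ h))
  | andL₂ hA _ ih => exact andL₂ (h hA) (ih (List.cons_subset_cons _ h))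
  | andR _ _ ihp ihq => exact andR (ihp h) (ihq h)
  | orL hA _ _ ihp ihq =>
    exact orL (h hA) (ihp (List.cons_subset_cons _ h)) (ihq (List.cons_subset_cons _ h))
  | orR₁ _ ih => exact orR₁ (ih h)
  | orR₂ _ ih => exact orR₂ (ih h)
  | impL hA _ _ ihp ihq => exact impL (h hA) (ihp h) (ihq (List.cons_subset_cons _ h))
  | impR _ ih => exact impR (ih (List.cons_subset_cons _ h))
  | allL hA t _ ih => exact allL (h hA) t (ih (List.cons_subset_cons _ h))
  | allR _ ih => exact allR fun t => ih t h
  | exL hA _ ih => exact exL (h hA) fun t => ih t (List.cons_subset_cons _ h)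
  | exR t _ ih => exact exR t (ih h)
  | tnd hS A _ _ ihp ihq =>
    exact tnd hS A (ihp (List.cons_subset_cons _ h)) (ihq (List.cons_subset_cons _ h))

/-! ### Cut elimination in the auxiliary calculus -/

/-- The premises of the rule that introduces the outermost logical symbol of the formula on the
right are derivable from `Γ`. -/
def RightPremises (S : System) (n : ℕ) (Γ : List (Formula L)) : Formula L → Prop
  | .rel _ _ => False
  | .neg A => Derives S n (A :: Γ) none
  | .and A B => Derives S n Γ (some A) ∧ Derives S n Γ (some B)
  | .or A B => Derives S n Γ (some A) ∨ Derives S n Γ (some B)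
  | .imp A B => Derives S n (A :: Γ) (some B)
  | .all A => ∀ t, Derives S n Γ (some (A.inst t))
  | .ex A => ∃ t, Derives S n Γ (some (A.inst t))

theorem RightPremises.weaken {Γ Γ' : List (Formula L)} {C : Formula L}
    (hC : RightPremises S n Γ C) (h : Γ ⊆ Γ') : RightPremises S n Γ' C := by
  match C, hC with
  | .neg A, hC => exact Derives.weaken hC (List.cons_subset_cons A h)
  | .and A B, hC => exact ⟨hC.1.weaken h, hC.2.weaken h⟩
  | .or A B, hC => exact hC.imp (·.weaken h) (·.weaken h)
  | .imp A B, hC => exact Derives.weaken hC (List.cons_subset_cons A h)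
  | .all A, hC => exact fun t => (hC t).weaken h
  | .ex A, hC => exact hC.imp fun t p => p.weaken h

theorem RightPremises.derives {Γ : List (Formula L)} {C : Formula L}
    (hC : RightPremises S n Γ C) : Derives S n Γ (some C) := by
  match C, hC with
  | .neg A, hC => exact negR hC
  | .and A B, hC => exact andR hC.1 hC.2
  | .or A B, hC => exact hC.elim orR₁ orR₂
  | .imp A B, hC => exact impR hC
  | .all A, hC => exact allR hC
  | .ex A, hC => exact hC.elim fun t p => exR t p

theorem subset_cons_swap {α : Type*} {Δ Γ : List α} {C : α} (h : Δ ⊆ C :: Γ) (A : α) :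
    A :: Δ ⊆ C :: A :: Γ := by
  intro B hB
  have := @h B
  simp only [List.mem_cons] at *
  tauto

/-- Elimination of a formula of degree `≤ n` that was introduced on the right. -/
theorem cut_of_rightPremises {C : Formula L} (hn : C.degree ≤ n) {Γ Δ : List (Formula L)}
    {Λ : Option (Formula L)} (hC : RightPremises S n Γ C) (q : Derives S n Δ Λ)
    (h : Δ ⊆ C :: Γ) : Derives S n Γ Λ := by
  have weak : ∀ {Γ : List (Formula L)} (A : Formula L), RightPremises S n Γ C →
      RightPremises S n (A :: Γ) C := fun A hC => hC.weaken (List.subset_cons_self A _)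
  -- `Γ` has to vary, since premises enlarge the antecedent; `weak` carries the right premises of
  -- `C` along.
  induction q generalizing Γ with
  | ax hA =>
    rcases List.mem_cons.1 (h hA) with rfl | hA
    · exact hC.derives
    · exact ax hA
  | cut A hA _ _ ihp ihq => exact cut A hA (ihp hC h) (ihq (weak _ hC) (subset_cons_swap h A))
  | negL hA _ ih =>
    have p := ih hC h
    rcases List.mem_cons.1 (h hA) with rfl | hA
    -- The bound `hn` on the degree of a negation unfolds to the strict bound on the negated
    -- formula.
    · exact cut _ hn p hC
    · exact negL hA p
  | negR _ ih => exact negR (ih (weak _ hC) (subset_cons_swap h _))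
  | andL₁ hA _ ih =>
    have p := ih (weak _ hC) (subset_cons_swap h _)
    rcases List.mem_cons.1 (h hA) with rfl | hA
    · exact cut _ (lt_of_lt_of_le (Nat.lt_succ_of_le (le_max_left _ _)) hn) hC.1 p
    · exact andL₁ hA p
  | andL₂ hA _ ih =>
    have p := ih (weak _ hC) (subset_cons_swap h _)
    rcases List.mem_cons.1 (h hA) with rfl | hA
    · exact cut _ (lt_of_lt_of_le (Nat.lt_succ_of_le (le_max_right _ _)) hn) hC.2 p
    · exact andL₂ hA p
  | andR _ _ ihp ihq => exact andR (ihp hC h) (ihq hC h)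
  | orL hA _ _ ihp ihq =>
    have p := ihp (weak _ hC) (subset_cons_swap h _)
    have q := ihq (weak _ hC) (subset_cons_swap h _)
    rcases List.mem_cons.1 (h hA) with rfl | hA
    · rcases hC with hC | hC
      · exact cut _ (lt_of_lt_of_le (Nat.lt_succ_of_le (le_max_left _ _)) hn) hC p
      · exact cut _ (lt_of_lt_of_le (Nat.lt_succ_of_le (le_max_right _ _)) hn) hC q
    · exact orL hA p q
  | orR₁ _ ih => exact orR₁ (ih hC h)
  | orR₂ _ ih => exact orR₂ (ih hC h)
  | impL hA _ _ ihp ihq =>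
    have p := ihp hC h
    have q := ihq (weak _ hC) (subset_cons_swap h _)
    rcases List.mem_cons.1 (h hA) with rfl | hA
    -- For `C = A ⊃ B`, a cut on `A` yields `B`, and a second cut removes `B`.
    · exact cut _ (lt_of_lt_of_le (Nat.lt_succ_of_le (le_max_right _ _)) hn)
        (cut _ (lt_of_lt_of_le (Nat.lt_succ_of_le (le_max_left _ _)) hn) p hC) q
    · exact impL hA p q
  | impR _ ih => exact impR (ih (weak _ hC) (subset_cons_swap h _))
  | allL hA t _ ih =>
    have p := ih (weak _ hC) (subset_cons_swap h _)
    rcases List.mem_cons.1 (h hA) with rfl | hA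
    · exact cut _ ((Fml.degree_inst t _).trans_lt hn) (hC t) p
    · exact allL hA t p
  | allR _ ih => exact allR fun t => ih t hC h
  | exL hA _ ih =>
    have p := fun t => ih t (weak _ hC) (subset_cons_swap h _)
    rcases List.mem_cons.1 (h hA) with rfl | hA
    · obtain ⟨t, hC⟩ := hC
      exact cut _ ((Fml.degree_inst t _).trans_lt hn) hC (p t)
    · exact exL hA p
  | exR t _ ih => exact exR t (ih hC h)
  | tnd hS A _ _ ihp ihq =>
    exact tnd hS A (ihp (weak _ hC) (subset_cons_swap h _)) (ihq (weak _ hC) (subset_cons_swap h _))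

/-- Elimination of a cut of degree `≤ n`. -/
theorem cut_admissible {C : Formula L} (hn : C.degree ≤ n) {Γ : List (Formula L)}
    {Λ : Option (Formula L)} (p : Derives S n Γ (some C)) (q : Derives S n (C :: Γ) Λ) :
    Derives S n Γ Λ := by
  have weak : ∀ {Γ : List (Formula L)} (A : Formula L), Derives S n (C :: Γ) Λ →
      Derives S n (C :: A :: Γ) Λ := fun A q => q.weaken (by
    intro B
    simp only [List.mem_cons]
    tauto)
  generalize hD : some C = D at p
  induction p with
  | ax hA =>
    obtain rfl := Option.some.inj hD
    exact q.weaken (List.cons_subset.2 ⟨hA, List.Subset.refl _⟩)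
  -- The left premise has succedent `A` and stays as it is; only the right premise has succedent
  -- `C`. The same holds for `impL`.
  | cut A hA p _ _ ihq => exact cut A hA p (ihq (weak _ q) hD)
  | negL => cases hD
  | negR p =>
    obtain rfl := Option.some.inj hD
    exact cut_of_rightPremises hn p q (List.Subset.refl _)
  | andL₁ hA _ ih => exact andL₁ hA (ih (weak _ q) hD)
  | andL₂ hA _ ih => exact andL₂ hA (ih (weak _ q) hD)
  | andR p₁ p₂ =>
    obtain rfl := Option.some.inj hD
    exact cut_of_rightPremises hn ⟨p₁, p₂⟩ q (List.Subset.refl _)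
  | orL hA _ _ ihp ihq => exact orL hA (ihp (weak _ q) hD) (ihq (weak _ q) hD)
  | orR₁ p =>
    obtain rfl := Option.some.inj hD
    exact cut_of_rightPremises hn (Or.inl p) q (List.Subset.refl _)
  | orR₂ p =>
    obtain rfl := Option.some.inj hD
    exact cut_of_rightPremises hn (Or.inr p) q (List.Subset.refl _)
  | impL hA p _ _ ihq => exact impL hA p (ihq (weak _ q) hD)
  | impR p =>
    obtain rfl := Option.some.inj hD
    exact cut_of_rightPremises hn p q (List.Subset.refl _)
  | allL hA t _ ih => exact allL hA t (ih (weak _ q) hD)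
  | allR p =>
    obtain rfl := Option.some.inj hD
    exact cut_of_rightPremises hn p q (List.Subset.refl _)
  | exL hA _ ih => exact exL hA fun t => ih t (weak _ q) hD
  | exR t p =>
    obtain rfl := Option.some.inj hD
    exact cut_of_rightPremises hn ⟨t, p⟩ q (List.Subset.refl _)
  | tnd hS A _ _ ihp ihq => exact tnd hS A (ihp (weak _ q) hD) (ihq (weak _ q) hD)

end Derives

/-! ### From proofs to derivations -/

section Proofs

variable {L : Language} {S : System} {n : ℕ}

/-- Positivity of `n` is needed for cut-free proofs, whose degree is the empty supremum `0`. -/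
theorem Proof.degree_lt_iff {Γ : List (Formula L)} {Λ : Option (Formula L)} (p : Proof S Γ Λ)
    (hn : 0 < n) : p.degree < n ↔ ∀ d ∈ p.cutDegrees, d < n :=
  Finset.sup_lt_iff hn

theorem cons_subset_cons_cons {α : Type*} (A B : α) (Γ : List α) : A :: Γ ⊆ A :: B :: Γ := by
  intro D
  simp only [List.mem_cons]
  tauto

/-- Every substitution instance of the end sequent of a proof is derivable. -/
theorem Proof.derives_subst {Γ : List (Formula L)} {Λ : Option (Formula L)} (p : Proof S Γ Λ)
    (hp : ∀ d ∈ p.cutDegrees, d < n) (σ : ℕ → L.Term ℕ) :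
    Derives S n (Γ.map (Fml.subst σ)) (Λ.map (Fml.subst σ)) := by
  induction p generalizing σ with
  | ax A => exact .ax (List.mem_cons_self ..)
  | weakL A p ih => exact (ih hp σ).weaken (List.subset_cons_self ..)
  | contrL p ih =>
    exact (ih hp σ).weaken (List.cons_subset.2 ⟨List.mem_cons_self .., List.Subset.refl _⟩)
  | exchL p ih =>
    exact (ih hp σ).weaken (List.map_subset _ (List.Perm.append_left _ (.swap ..)).subset)
  | cut A p q ihp ihq =>
    simp only [cutDegrees, Finset.mem_union, Finset.mem_singleton] at hp
    rw [List.map_append]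
    refine .cut (A.subst σ) ((A.degree_subst σ).trans_lt (hp _ (Or.inl rfl)))
      ((ihp (fun d hd => hp d (.inr (.inl hd))) σ).weaken (List.subset_append_left ..))
      ((ihq (fun d hd => hp d (.inr (.inr hd))) σ).weaken
        (List.cons_subset_cons _ (List.subset_append_right ..)))
  | negL p ih => exact .negL (List.mem_cons_self ..) ((ih hp σ).weaken (List.subset_cons_self ..))
  | negR p ih => exact .negR (ih hp σ)
  | andL₁ B p ih =>
    exact .andL₁ (List.mem_cons_self ..) ((ih hp σ).weaken (cons_subset_cons_cons ..))
  | andL₂ A p ih =>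
    exact .andL₂ (List.mem_cons_self ..) ((ih hp σ).weaken (cons_subset_cons_cons ..))
  | andR p q ihp ihq =>
    simp only [cutDegrees, Finset.mem_union] at hp
    exact .andR (ihp (fun d hd => hp d (.inl hd)) σ) (ihq (fun d hd => hp d (.inr hd)) σ)
  | orL p q ihp ihq =>
    simp only [cutDegrees, Finset.mem_union] at hp
    exact .orL (List.mem_cons_self ..)
      ((ihp (fun d hd => hp d (.inl hd)) σ).weaken (cons_subset_cons_cons ..))
      ((ihq (fun d hd => hp d (.inr hd)) σ).weaken (cons_subset_cons_cons ..))
  | orR₁ B p ih => exact .orR₁ (ih hp σ)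
  | orR₂ A p ih => exact .orR₂ (ih hp σ)
  | impL p q ihp ihq =>
    simp only [cutDegrees, Finset.mem_union] at hp
    rw [List.map_cons, List.map_append]
    exact .impL (List.mem_cons_self ..)
      ((ihp (fun d hd => hp d (.inl hd)) σ).weaken
        (List.subset_cons_of_subset _ (List.subset_append_left ..)))
      ((ihq (fun d hd => hp d (.inr hd)) σ).weaken
        (List.cons_subset_cons _ (List.subset_cons_of_subset _ (List.subset_append_right ..))))
  | impR p ih => exact .impR (ih hp σ)
  | allL A t p ih =>
    have := ih hp σ
    rw [List.map_cons, Fml.subst_inst] at this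
    exact .allL (List.mem_cons_self ..) _ (this.weaken (cons_subset_cons_cons ..))
  | allR A a h p ih =>
    refine .allR fun t => ?_
    -- Sending the eigenvariable to `t` leaves the context unchanged, by freshness. This is why the
    -- induction runs over all `σ`.
    have := ih hp (Function.update σ a t)
    rwa [(h.map_subst_update σ t).1, Option.map_some,
      Fml.subst_inst_var A (h.2 A.all rfl)] at this
  | exL A a h p ih =>
    refine .exL (List.mem_cons_self ..) fun t => ?_
    have hA : ¬ A.Occurs a := h.1 A.ex (List.mem_cons_self ..)
    have hΓ := (List.cons.inj (h.map_subst_update σ t).1).2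
    have := ih hp (Function.update σ a t)
    rw [List.map_cons, hΓ, (h.map_subst_update σ t).2, Fml.subst_inst_var A hA] at this
    exact this.weaken (cons_subset_cons_cons ..)
  | exR A t p ih =>
    have := ih hp σ
    rw [Option.map_some, Fml.subst_inst] at this
    exact .exR _ this
  | tnd h A p q ihp ihq =>
    simp only [cutDegrees, Finset.mem_union] at hp
    exact .tnd h (A.subst σ) (ihp (fun d hd => hp d (.inl hd)) σ)
      (ihq (fun d hd => hp d (.inr hd)) σ)

theorem Proof.derives {Γ : List (Formula L)} {Λ : Option (Formula L)} (p : Proof S Γ Λ)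
    (hp : ∀ d ∈ p.cutDegrees, d < n) : Derives S n Γ Λ := by
  have h : (Fml.subst Term.var : Formula L → Formula L) = id := funext Fml.subst_var
  have := p.derives_subst hp Term.var
  rwa [h, List.map_id, Option.map_id, id] at this

/-! ### From derivations back to proofs -/

/-- There is a proof of `Γ → Λ` in `S` all of whose cuts have degree `< n`. -/
def Provable (S : System) (n : ℕ) (Γ : List (Formula L)) (Λ : Option (Formula L)) : Prop :=
  ∃ p : Proof S Γ Λ, ∀ d ∈ p.cutDegrees, d < n

namespace Provable

theorem perm {Γ Γ' : List (Formula L)} {Λ : Option (Formula L)} (h : Γ.Perm Γ')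
    (p : Provable S n Γ Λ) : Provable S n Γ' Λ := by
  -- An arbitrary prefix `Δ` absorbs the common heads, so that an exchange can happen deep inside
  -- the antecedent.
  suffices ∀ Δ, Provable S n (Δ ++ Γ) Λ → Provable S n (Δ ++ Γ') Λ from this [] p
  clear p
  induction h with
  | nil => exact fun _ => id
  | cons A _ ih => exact fun Δ p => by simpa using ih (Δ ++ [A]) (by simpa using p)
  | swap A B Γ => exact fun Δ ⟨p, hp⟩ => ⟨p.exchL, hp⟩
  | trans _ _ ih₁ ih₂ => exact fun Δ p => ih₂ Δ (ih₁ Δ p)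

theorem append_left {Γ : List (Formula L)} {Λ : Option (Formula L)} (p : Provable S n Γ Λ) :
    ∀ Δ, Provable S n (Δ ++ Γ) Λ
  | [] => p
  | A :: Δ => (p.append_left Δ).elim fun p hp => ⟨p.weakL A, hp⟩

/-- Each formula of `Γ` is moved next to a copy of it in `Γ'` and contracted. -/
theorem contract {Γ Γ' : List (Formula L)} {Λ : Option (Formula L)} (h : Γ ⊆ Γ')
    (p : Provable S n (Γ ++ Γ') Λ) : Provable S n Γ' Λ := by
  induction Γ with
  | nil => exact p
  | cons A Γ ih =>
    obtain ⟨hA, h⟩ := List.cons_subset.1 h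
    refine ih h ?_
    obtain ⟨s, t, rfl⟩ := List.append_of_mem hA
    have hperm : (Γ ++ (s ++ A :: t)).Perm (A :: (Γ ++ (s ++ t))) :=
      (List.perm_middle.append_left Γ).trans List.perm_middle
    obtain ⟨p, hp⟩ := p.perm (hperm.cons A)
    exact perm hperm.symm ⟨p.contrL, hp⟩

theorem weaken {Γ Γ' : List (Formula L)} {Λ : Option (Formula L)} (p : Provable S n Γ Λ)
    (h : Γ ⊆ Γ') : Provable S n Γ' Λ :=
  contract h ((p.append_left Γ').perm List.perm_append_comm)

theorem contract_mem {Γ : List (Formula L)} {Λ : Option (Formula L)} {A : Formula L} (h : A ∈ Γ)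
    (p : Provable S n (A :: Γ) Λ) : Provable S n Γ Λ :=
  p.weaken (List.cons_subset.2 ⟨h, List.Subset.refl _⟩)

end Provable

theorem Derives.provable {Γ : List (Formula L)} {Λ : Option (Formula L)} (p : Derives S n Γ Λ) :
    Provable S n Γ Λ := by
  induction p with
  | ax h =>
    exact Provable.weaken ⟨.ax _, by simp [Proof.cutDegrees]⟩ (List.cons_subset.2 ⟨h, List.nil_subset _⟩)
  | cut A h _ _ ihp ihq =>
    obtain ⟨p, hp⟩ := ihp
    obtain ⟨q, hq⟩ := ihq
    refine Provable.contract (List.Subset.refl _) ⟨.cut A p q, ?_⟩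
    simp only [Proof.cutDegrees, Finset.mem_union, Finset.mem_singleton]
    rintro d (rfl | hd | hd)
    exacts [h, hp d hd, hq d hd]
  | negL h _ ih => exact ih.elim fun p hp => Provable.contract_mem h ⟨p.negL, hp⟩
  | negR _ ih => exact ih.elim fun p hp => ⟨p.negR, hp⟩
  | andL₁ h _ ih => exact ih.elim fun p hp => Provable.contract_mem h ⟨p.andL₁ _, hp⟩
  | andL₂ h _ ih => exact ih.elim fun p hp => Provable.contract_mem h ⟨p.andL₂ _, hp⟩
  | andR _ _ ihp ihq =>
    obtain ⟨p, hp⟩ := ihp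
    obtain ⟨q, hq⟩ := ihq
    exact ⟨.andR p q, fun d hd => (Finset.mem_union.1 hd).elim (hp d) (hq d)⟩
  | orL h _ _ ihp ihq =>
    obtain ⟨p, hp⟩ := ihp
    obtain ⟨q, hq⟩ := ihq
    exact Provable.contract_mem h
      ⟨.orL p q, fun d hd => (Finset.mem_union.1 hd).elim (hp d) (hq d)⟩
  | orR₁ _ ih => exact ih.elim fun p hp => ⟨p.orR₁ _, hp⟩
  | orR₂ _ ih => exact ih.elim fun p hp => ⟨p.orR₂ _, hp⟩
  | impL h _ _ ihp ihq =>
    obtain ⟨p, hp⟩ := ihp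
    obtain ⟨q, hq⟩ := ihq
    exact Provable.contract (List.Subset.refl _) (Provable.contract_mem
      (List.mem_append_left _ h)
      ⟨.impL p q, fun d hd => (Finset.mem_union.1 hd).elim (hp d) (hq d)⟩)
  | impR _ ih => exact ih.elim fun p hp => ⟨p.impR, hp⟩
  | allL h t _ ih => exact ih.elim fun p hp => Provable.contract_mem h ⟨p.allL _ t, hp⟩
  | @allR Γ A _ ih =>
    -- Of the premises for all terms, only the one at a fresh variable is used.
    obtain ⟨a, ha⟩ := exists_fresh Γ (some A.all)
    exact (ih (Term.var a)).elim fun p hp => ⟨p.allR A a ha, hp⟩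
  | @exL Γ Λ A h _ ih =>
    obtain ⟨a, ha⟩ := exists_fresh (A.ex :: Γ) Λ
    exact (ih (Term.var a)).elim fun p hp => Provable.contract_mem h ⟨p.exL A a ha, hp⟩
  | exR t _ ih => exact ih.elim fun p hp => ⟨p.exR _ t, hp⟩
  | tnd h A _ _ ihp ihq =>
    obtain ⟨p, hp⟩ := ihp
    obtain ⟨q, hq⟩ := ihq
    exact ⟨.tnd h A p q, fun d hd => (Finset.mem_union.1 hd).elim (hp d) (hq d)⟩

/-- As antecedents act as sets in `Derives`, this inclusion is all that is needed about the
deletion. -/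
theorem Deletion.subset {C : Formula L} {Δ Δ' : List (Formula L)} (h : Deletion C Δ Δ') :
    Δ ⊆ C :: Δ' := by
  induction h with
  | nil => exact List.nil_subset _
  | keep A _ ih => exact Derives.subset_cons_swap ih A
  | drop _ ih => exact List.cons_subset.2 ⟨List.mem_cons_self .., ih⟩

end Proofs

end MinLogic

theorem lemma3 {L : FirstOrder.Language} (S : MinLogic.System) (n : ℕ) (C : MinLogic.Formula L)
    (hC : C.degree = n) (Γ Δ : List (MinLogic.Formula L)) (Λ : Option (MinLogic.Formula L))
    (p : MinLogic.Proof S Γ (some C)) (hp : p.degree < n)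
    (q : MinLogic.Proof S Δ Λ) (hq : q.degree < n)
    (Δ' : List (MinLogic.Formula L)) (hΔ' : MinLogic.Deletion C Δ Δ') :
    ∃ r : MinLogic.Proof S (Γ ++ Δ') Λ, r.degree < n := by
  have hn : 0 < n := (Nat.zero_le _).trans_lt hp
  -- Both derivations are weakened to the common context `Γ ++ Δ'`, with `C` added in the second.
  have hp' := (p.derives ((p.degree_lt_iff hn).1 hp)).weaken (List.subset_append_left Γ Δ')
  have hq' := (q.derives ((q.degree_lt_iff hn).1 hq)).weaken
    (List.Subset.trans hΔ'.subset (List.cons_subset_cons C (List.subset_append_right Γ Δ')))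
  obtain ⟨r, hr⟩ := (MinLogic.Derives.cut_admissible hC.le hp' hq').provable
  exact ⟨r, (r.degree_lt_iff hn).2 hr⟩
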